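/- Let $\mathfrak g$ be a real Lie algebra of dimension $n$ with basis $X_1,\dots,X_n$ and structure constants $\Gamma_{ij}^s$, $[X_i,X_j]=\sum_{s}\Gamma_{ij}^sX_s$, and let $N$ be a natural number. Write points of the phase space $(\mathfrak g^*)^N\cong\mathbb R^{Nn}$ as $\mu=(\mu_{ki})_{1\le k\le N,\,1\le i\le n}$, where $\mu_{ki}$ are the coefficients of $\mu_k\in\mathfrak g^*$ in the dual basis, and use the Euclidean norm $|\cdot|$ of these coordinates. Let $$\Lambda(\mu)=-\tfrac1{\sqrt2}\,\mathrm{diag}(\widehat\mu_1,\dots,\widehat\mu_N),\qquad \widehat\mu_k=-\sum_{s=1}^n\mu_{ks}\,(\Gamma_{ij}^s)_{i,j=1}^n ,$$ be the Lie–Poisson tensor; the Lie–Poisson equation with Hamiltonian $h$ is $\dot\mu=\Lambda(\mu)\nabla h(\mu)$. For $\alpha\in\mathfrak g^N$ let $\langle\alpha,\mu\rangle=\sum_k\langle\alpha_k,\mu_k\rangle$ be the duality pairing. Let $\sigma:\mathbb R\to\mathbb R$ be smooth, monotonically increasing (in the weak sense) and not a polynomial. Let $h:(\mathfrak g^*)^N\to\mathbb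 R$ be smooth, let $U\subset(\mathfrak g^*)^N$ be compact, $T>0$ and $\varepsilon>0$, and put $U_\varepsilon=\{x\in U:\ \mathrm{dist}(x,\partial U)>\varepsilon\}$ (the distance to an empty boundary being $+\infty$). Then there are an integer $M>0$, vectors $\alpha_1,\dots,\alpha_M\in\mathfrak g^N$, numbers $\beta_1,\dots,\beta_M\in\mathbb R$ and signs $s_1,\dots,s_M\in\{1,-1\}$, with all $s_j=1$ if $\sigma$ is bounded (e.g. a sigmoid), such that the flow of $$h_{\rm approx}(\mu)=\sum_{j=1}^M s_j\,\sigma(\langle\alpha_j,\mu\rangle+\beta_j)$$ approximates the flow of $h$ up to $\varepsilon$ on $[0,T)$ as long as the latter does not leave $U_\varepsilon$. That is: for every $0<\tau\le T$ and every solution $x:[0,\tau)\to(\mathfrak g^*)^N$ of $\dot x=\Lambda(x)\nabla h(x)$ with $x(t)\in U_\varepsilon$ for all $0\le t<\tau$, the equation $\dot y=\Lambda(y)\nabla h_{\rm approx}(y)$, $y(0)=x(0)$, has a solution on $[0,\tau)$, and every such solution satisfies $|x(t)-y(t)|<\varepsilon$ for all $0\le t<\tau$. -/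

import Mathlib

open scoped ContDiff

noncomputable section

namespace LiePoisson

/-- The phase space `(𝔤*)^N` of `N` interacting particles, `dim 𝔤 = n`, in coordinates: the
component `μ (k, i)` is the `i`-th coefficient of the momentum `μ_k ∈ 𝔤*` of the `k`-th particle in
the basis of `𝔤*` dual to a fixed basis of `𝔤`. It carries the Euclidean norm of `ℝ^{Nn}`. -/
abbrev PhaseSpace (N n : ℕ) : Type := EuclideanSpace ℝ (Fin N × Fin n)

/-- The structure constants `Γ_{ij}^s` of the Lie algebra in the basis `X`:
`[X_i, X_j] = ∑ s, Γ_{ij}^s X_s`. -/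
def structureConst {𝔤 : Type*} [LieRing 𝔤] [LieAlgebra ℝ 𝔤] {n : ℕ}
    (X : Module.Basis (Fin n) ℝ 𝔤) (i j s : Fin n) : ℝ :=
  X.repr ⁅X i, X j⁆ s

/-- The `n × n` matrix `μ̂_k = - ∑ s, μ_{ks} (Γ_{ij}^s)_{ij}`. -/
def muHat {𝔤 : Type*} [LieRing 𝔤] [LieAlgebra ℝ 𝔤] {N n : ℕ}
    (X : Module.Basis (Fin n) ℝ 𝔤) (μ : PhaseSpace N n) (k : Fin N) : Matrix (Fin n) (Fin n) ℝ :=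
  -∑ s, μ (k, s) • Matrix.of fun i j => structureConst X i j s

/-- The Poisson tensor `Λ(μ) = -(1/√2) diag(μ̂_1, …, μ̂_N)`, a block diagonal matrix. -/
def poissonTensor {𝔤 : Type*} [LieRing 𝔤] [LieAlgebra ℝ 𝔤] {N n : ℕ}
    (X : Module.Basis (Fin n) ℝ 𝔤) (μ : PhaseSpace N n) :
    Matrix (Fin N × Fin n) (Fin N × Fin n) ℝ :=
  (-(1 / Real.sqrt 2)) •
    Matrix.of fun p q => if p.1 = q.1 then muHat X μ p.1 p.2 q.2 else 0

/-- The Hamiltonian (Lie–Poisson) vector field `μ ↦ Λ(μ) ∇h(μ)`. -/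
def hamiltonianField {𝔤 : Type*} [LieRing 𝔤] [LieAlgebra ℝ 𝔤] {N n : ℕ}
    (X : Module.Basis (Fin n) ℝ 𝔤) (h : PhaseSpace N n → ℝ) (μ : PhaseSpace N n) :
    PhaseSpace N n :=
  WithLp.toLp 2 ((poissonTensor X μ).mulVec (WithLp.ofLp (gradient h μ)))

/-- The curve `x` solves `dμ/dt = Λ(μ) ∇h(μ)` on the time interval `0 ≤ t < τ`. -/
def IsSolutionOn {𝔤 : Type*} [LieRing 𝔤] [LieAlgebra ℝ 𝔤] {N n : ℕ}
    (X : Module.Basis (Fin n) ℝ 𝔤) (h : PhaseSpace N n → ℝ) (τ : ℝ)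
    (x : ℝ → PhaseSpace N n) : Prop :=
  IsIntegralCurveOn x (fun _ => hamiltonianField X h) (Set.Ico 0 τ)

/-- The duality pairing `⟨α, μ⟩ = ∑ k, ⟨α_k, μ_k⟩` of `α ∈ 𝔤^N` with `μ ∈ (𝔤*)^N`. -/
def pairing {𝔤 : Type*} [LieRing 𝔤] [LieAlgebra ℝ 𝔤] {N n : ℕ}
    (X : Module.Basis (Fin n) ℝ 𝔤) (α : Fin N → 𝔤) (μ : PhaseSpace N n) : ℝ :=
  ∑ k, ∑ i, X.repr (α k) i * μ (k, i)

/-- The set `U_ε` of the points of `U` whose distance to the boundary of `U` is more than `ε`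
(extended distance: the distance to an empty boundary is infinite). -/
def innerSet {N n : ℕ} (U : Set (PhaseSpace N n)) (ε : ℝ) : Set (PhaseSpace N n) :=
  {x | x ∈ U ∧ ENNReal.ofReal ε < Metric.infEDist x (frontier U)}

/-- The Hamiltonian `μ ↦ ∑ j, s_j σ(⟨α_j, μ⟩ + β_j)`. -/
def hApprox {𝔤 : Type*} [LieRing 𝔤] [LieAlgebra ℝ 𝔤] {N n M : ℕ}
    (X : Module.Basis (Fin n) ℝ 𝔤) (σ : ℝ → ℝ) (s : Fin M → ℝ) (α : Fin M → Fin N → 𝔤)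
    (β : Fin M → ℝ) (μ : PhaseSpace N n) : ℝ :=
  ∑ j, s j * σ (pairing X (α j) μ + β j)

end LiePoisson

end

/-!
The Hamiltonian vector field depends on the Hamiltonian through its gradient only, so the theorem
reduces to two facts: the gradients of the Hamiltonians `∑ j, s_j σ(⟨α_j, μ⟩ + β_j)` are uniformly
dense on a compact set among the gradients of smooth functions (`exists_hApprox_gradient_near`), and
trajectories of uniformly close fields stay close (`dist_lt_of_field_near`).

Density. As the sums carry no coefficients but signs, the closure `S` of their gradients in
`C(U, ℝ^{Nn})` is only a closed additive semigroup. It nevertheless contains every real multiple of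
every field `x ↦ ⟨a, x⟩ ^ k a` (`smul_monomialField_mem`). By Taylor's formula, `n ^ (k + 1)` copies
of the neuron `s σ(⟨a, x⟩ / n + β)` have the gradient `s σ⁽ᵏ⁺¹⁾(β) / k! ⟨a, x⟩ ^ k a`, plus multiples
of fields of lower degree, which lie in `S` by induction together with their negatives, plus `o(1)`.
The factor `s σ⁽ᵏ⁺¹⁾(β)` is nonzero for some `β`, since `σ` is not a polynomial, and a positive
scaling of `a` adjusts its absolute value. Its sign is adjusted by `a ↦ -a` if `k + 1` is odd and by
`s` if `σ` is unbounded. If `k + 1` is even and `σ` is bounded, then `σ⁽ᵏ⁺¹⁾` itself takes both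
signs, for otherwise `σ⁽ᵏ⁾` would be monotone, and a nonzero value of it would make `σ` unbounded
(`exists_polynomial_of_bounded_of_iteratedDeriv_nonneg`).

It remains to see that the gradients of polynomials are dense (`gradient_mem`). By Fourier inversion,
the gradient of a smooth function of compact support is a Bochner integral in `C(U, ℝ^{Nn})` of
ridge fields `x ↦ φ(⟨ξ, x⟩) ξ`, and each of these is a limit of polynomial ones by the Weierstrass
theorem in one variable.

Dynamics. Multiplied by a cut-off function, `h` has a globally Lipschitz field, and Grönwall's
inequality bounds the distance of the two trajectories below `ε` as long as the approximate one
stays in `U`; as the `ε`-balls around points of `U_ε` lie in `U`, there is no first time at which the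
distance `ε` is reached. The approximate trajectory exists because the field of the approximate Hamiltonian, cut off
outside `U`, is bounded and Lipschitz.
-/

open scoped ContDiff

namespace LiePoisson

open Filter Topology Set

/-! ### One-variable functions with a derivative of constant sign -/

theorem exists_polynomial_deriv_eq (p : Polynomial ℝ) :
    ∃ q : Polynomial ℝ, q.derivative = p := by
  induction p using Polynomial.induction_on' with
  | add p q hp hq =>
    obtain ⟨p', rfl⟩ := hp
    obtain ⟨q', rfl⟩ := hq
    exact ⟨p' + q', by simp⟩
  | monomial k a =>
    refine ⟨Polynomial.monomial (k + 1) (a / (k + 1)), ?_⟩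
    rw [Polynomial.derivative_monomial]
    have : (k : ℝ) + 1 ≠ 0 := by positivity
    simp [this]

theorem exists_polynomial_of_iteratedDeriv_eq_zero (m : ℕ) {f : ℝ → ℝ} (hf : ContDiff ℝ ∞ f)
    (h0 : ∀ x, iteratedDeriv m f x = 0) : ∃ p : Polynomial ℝ, ∀ x, f x = p.eval x := by
  induction m generalizing f with
  | zero => exact ⟨0, by simpa using h0⟩
  | succ m ih =>
    have hd : ContDiff ℝ ∞ (deriv f) := (contDiff_infty_iff_deriv.1 hf).2
    obtain ⟨p, hp⟩ := ih hd (by simpa [iteratedDeriv_succ'] using h0)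
    obtain ⟨q, rfl⟩ := exists_polynomial_deriv_eq p
    have hfd : Differentiable ℝ f := hf.differentiable (by simp)
    refine ⟨q + Polynomial.C (f 0 - q.eval 0), fun x => ?_⟩
    have := is_const_of_deriv_eq_zero (f := fun x => f x - q.eval x)
      (hfd.sub q.differentiable) (fun x => by
        rw [deriv_fun_sub (hfd x) q.differentiable.differentiableAt, hp, Polynomial.deriv, sub_self])
      x 0
    simp only [Polynomial.eval_add, Polynomial.eval_C]
    linarith

/-- A function one of whose derivatives of positive order is eventually bounded below by a positive
constant grows without bound. -/
theorem tendsto_atTop_of_iteratedDeriv_ge (m : ℕ) {f : ℝ → ℝ} (hf : ContDiff ℝ ∞ f) {c a : ℝ}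
    (hc : 0 < c) (hge : ∀ x ≥ a, c ≤ iteratedDeriv (m + 1) f x) : Tendsto f atTop atTop := by
  induction m generalizing f c a with
  | zero =>
    have hfd : Differentiable ℝ f := hf.differentiable (by simp)
    have key : ∀ x ≥ a, f a + c * (x - a) ≤ f x := by
      intro x hx
      have := (convex_Ici a).mul_sub_le_image_sub_of_le_deriv (f := f) hf.continuous.continuousOn
        hfd.differentiableOn (C := c) (fun y hy => by
          rw [interior_Ici] at hy
          simpa using hge y (le_of_lt hy)) a self_mem_Ici x hx hx
      linarith
    refine tendsto_atTop_mono' atTop ((eventually_ge_atTop a).mono key) ?_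
    refine tendsto_atTop_add_const_left _ _ (Tendsto.const_mul_atTop hc ?_)
    exact tendsto_atTop_add_const_right _ (-a) tendsto_id
  | succ m ih =>
    have hd : ContDiff ℝ ∞ (deriv f) := (contDiff_infty_iff_deriv.1 hf).2
    have h1 : Tendsto (deriv f) atTop atTop :=
      ih hd hc (fun x hx => by simpa [iteratedDeriv_succ'] using hge x hx)
    obtain ⟨b, hb⟩ := (tendsto_atTop.1 h1 1).exists_forall_of_atTop
    have hfd : Differentiable ℝ f := hf.differentiable (by simp)
    have key : ∀ x ≥ b, f b + 1 * (x - b) ≤ f x := by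
      intro x hx
      have := (convex_Ici b).mul_sub_le_image_sub_of_le_deriv (f := f) hf.continuous.continuousOn
        hfd.differentiableOn (C := 1) (fun y hy => by
          rw [interior_Ici] at hy
          simpa using hb y (le_of_lt hy)) b self_mem_Ici x hx hx
      linarith
    refine tendsto_atTop_mono' atTop ((eventually_ge_atTop b).mono key) ?_
    refine tendsto_atTop_add_const_left _ _ (Tendsto.const_mul_atTop one_pos ?_)
    exact tendsto_atTop_add_const_right _ (-b) tendsto_id

theorem iteratedDeriv_succ_nonpos_of_bounded {f : ℝ → ℝ} (hf : ContDiff ℝ ∞ f)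
    (hb : ∃ C, ∀ x, |f x| ≤ C) (m : ℕ) (h0 : ∀ x, 0 ≤ iteratedDeriv (m + 2) f x) (x : ℝ) :
    iteratedDeriv (m + 1) f x ≤ 0 := by
  by_contra! hx
  have hmono : Monotone (iteratedDeriv (m + 1) f) := by
    refine monotone_of_deriv_nonneg (hf.differentiable_iteratedDeriv (m + 1) (by
      exact_mod_cast ENat.natCast_lt_top _)) fun y => ?_
    rw [← iteratedDeriv_succ]
    exact h0 y
  have ht := tendsto_atTop_of_iteratedDeriv_ge m hf hx (fun y hy => hmono hy)
  obtain ⟨C, hC⟩ := hb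
  obtain ⟨y, hy⟩ := (ht.eventually_gt_atTop C).exists
  exact absurd ((le_abs_self _).trans (hC y)) (not_le.2 hy)

/-- A bounded smooth function, a derivative of which of order at least two is nonnegative, is a
polynomial: the derivative of one order less is monotone, and a nonzero value of it would force
growth at `+∞` or at `-∞`. -/
theorem exists_polynomial_of_bounded_of_iteratedDeriv_nonneg {f : ℝ → ℝ} (hf : ContDiff ℝ ∞ f)
    (hb : ∃ C, ∀ x, |f x| ≤ C) (m : ℕ) (h0 : ∀ x, 0 ≤ iteratedDeriv (m + 2) f x) :
    ∃ p : Polynomial ℝ, ∀ x, f x = p.eval x := by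
  refine exists_polynomial_of_iteratedDeriv_eq_zero (m + 1) hf fun x => ?_
  refine le_antisymm (iteratedDeriv_succ_nonpos_of_bounded hf hb m h0 x) ?_
  -- the bound at `-∞` is the one at `+∞` for the reflected function
  set g : ℝ → ℝ := fun y => (-1) ^ m * f (-y) with hg
  have hgs : ContDiff ℝ ∞ g := contDiff_const.mul (hf.comp contDiff_neg)
  have hgd : ∀ k y, iteratedDeriv k g y = (-1) ^ m * ((-1) ^ k * iteratedDeriv k f (-y)) := by
    intro k y
    rw [hg, iteratedDeriv_const_mul_field, iteratedDeriv_comp_neg, smul_eq_mul]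
  have hgb : ∃ C, ∀ y, |g y| ≤ C := by
    obtain ⟨C, hC⟩ := hb
    exact ⟨C, fun y => by simpa [hg, abs_mul] using hC (-y)⟩
  have := iteratedDeriv_succ_nonpos_of_bounded hgs hgb m (fun y => by
    rw [hgd, ← mul_assoc, ← pow_add, show m + (m + 2) = 2 * (m + 1) by ring, pow_mul]
    simpa using h0 (-y)) (-x)
  rw [hgd, ← mul_assoc, ← pow_add, show m + (m + 1) = 2 * m + 1 by ring, pow_succ, pow_mul] at this
  simpa using this

/-! ### Coefficients of the rescaled activation function -/

theorem exists_iteratedDeriv_ne_zero {σ : ℝ → ℝ} (hσ : ContDiff ℝ ∞ σ)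
    (hpoly : ¬ ∃ p : Polynomial ℝ, ∀ ξ, σ ξ = p.eval ξ) (m : ℕ) :
    ∃ β, iteratedDeriv m σ β ≠ 0 := by
  by_contra! h
  exact hpoly (exists_polynomial_of_iteratedDeriv_eq_zero m hσ h)

theorem exists_iteratedDeriv_mul_pos_of_bounded {σ : ℝ → ℝ} (hσ : ContDiff ℝ ∞ σ)
    (hpoly : ¬ ∃ p : Polynomial ℝ, ∀ ξ, σ ξ = p.eval ξ) (hb : ∃ C, ∀ ξ, |σ ξ| ≤ C) (m : ℕ)
    {c : ℝ} (hc : c ≠ 0) : ∃ β, 0 < c * iteratedDeriv (m + 2) σ β := by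
  by_contra! h
  obtain ⟨C, hC⟩ := hb
  obtain ⟨p, hp⟩ := exists_polynomial_of_bounded_of_iteratedDeriv_nonneg
    (f := fun x => -c * σ x) (contDiff_const.mul hσ)
    ⟨|c| * C, fun x => by
      rw [abs_mul, abs_neg]
      exact mul_le_mul_of_nonneg_left (hC x) (abs_nonneg c)⟩ m
    (fun x => by
      rw [iteratedDeriv_const_mul_field]
      linarith [h x])
  refine hpoly ⟨Polynomial.C (-c)⁻¹ * p, fun ξ => ?_⟩
  rw [Polynomial.eval_mul, Polynomial.eval_C, ← hp, inv_mul_cancel_left₀ (neg_ne_zero.2 hc)]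

/-- Every real number is a coefficient of degree `m + 1` of a rescaled copy `s σ(l ξ + β)` of `σ`
(up to the factorial), where the sign `s = -1` is used for unbounded `σ` only. In odd degree the
sign of the coefficient is adjusted by that of `l`; in even degree the derivative of a bounded `σ`
takes values of both signs. -/
theorem exists_sign_mul_pow_mul_iteratedDeriv_eq {σ : ℝ → ℝ} (hσ : ContDiff ℝ ∞ σ)
    (hpoly : ¬ ∃ p : Polynomial ℝ, ∀ ξ, σ ξ = p.eval ξ) (m : ℕ) (c : ℝ) :
    ∃ s β l : ℝ, (s = 1 ∨ s = -1 ∧ ¬ ∃ C, ∀ ξ, |σ ξ| ≤ C) ∧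
      s * l ^ (m + 1) * iteratedDeriv (m + 1) σ β = c := by
  rcases eq_or_ne c 0 with rfl | hc
  · exact ⟨1, 0, 0, by simp⟩
  suffices H : ∃ s β e : ℝ, (s = 1 ∨ s = -1 ∧ ¬ ∃ C, ∀ ξ, |σ ξ| ≤ C) ∧
      0 < c * (s * e ^ (m + 1) * iteratedDeriv (m + 1) σ β) by
    obtain ⟨s, β, e, hs, hpos⟩ := H
    set d := s * e ^ (m + 1) * iteratedDeriv (m + 1) σ β with hd
    have hd0 : d ≠ 0 := by
      rintro h
      simp [h] at hpos
    have hcd : 0 ≤ c / d := by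
      rw [← mul_div_mul_right c d hd0]
      exact div_nonneg hpos.le (mul_self_nonneg d)
    refine ⟨s, β, e * (c / d) ^ (((m + 1 : ℕ) : ℝ)⁻¹), hs, ?_⟩
    rw [mul_pow, Real.rpow_inv_natCast_pow hcd (Nat.succ_ne_zero m)]
    calc s * (e ^ (m + 1) * (c / d)) * iteratedDeriv (m + 1) σ β = d * (c / d) := by
          rw [hd]; ring
      _ = c := mul_div_cancel₀ c hd0
  obtain ⟨β, hβ⟩ := exists_iteratedDeriv_ne_zero hσ hpoly (m + 1)
  rcases lt_or_gt_of_ne (mul_ne_zero hc hβ) with hneg | hpos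
  · rcases Nat.even_or_odd (m + 1) with heven | hodd
    · by_cases hb : ∃ C, ∀ ξ, |σ ξ| ≤ C
      · obtain ⟨r, rfl⟩ : ∃ r, m = r + 1 := by
          rcases m with _ | r
          · simp at heven
          · exact ⟨r, rfl⟩
        obtain ⟨β', hβ'⟩ := exists_iteratedDeriv_mul_pos_of_bounded hσ hpoly hb r hc
        exact ⟨1, β', 1, Or.inl rfl, by simpa using hβ'⟩
      · exact ⟨-1, β, 1, Or.inr ⟨rfl, hb⟩, by simpa using hneg⟩
    · exact ⟨1, β, -1, Or.inl rfl, by simpa [hodd.neg_one_pow] using hneg⟩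
  · exact ⟨1, β, 1, Or.inl rfl, by simpa using hpos⟩

/-! ### Ridge fields and the monomial fields generated by them -/

section Ridge

variable {E : Type*} [NormedAddCommGroup E] [InnerProductSpace ℝ E]

/-- The ridge field `x ↦ φ(⟨a, x⟩) a` on `K`: the gradient of `x ↦ Φ(⟨a, x⟩)` if `Φ' = φ`. -/
def ridgeField (K : Set E) (φ : C(ℝ, ℝ)) (a : E) : C(K, E) :=
  ⟨fun x => φ (inner ℝ a (x : E)) • a, by fun_prop⟩

@[simp]
theorem ridgeField_apply (K : Set E) (φ : C(ℝ, ℝ)) (a : E) (x : K) :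
    ridgeField K φ a x = φ (inner ℝ a (x : E)) • a := rfl

/-- The field `x ↦ ⟨a, x⟩ ^ k a`, the gradient of the polynomial `⟨a, x⟩ ^ (k + 1) / (k + 1)`. -/
def monomialField (K : Set E) (k : ℕ) (a : E) : C(K, E) :=
  ridgeField K ⟨fun t => t ^ k, by fun_prop⟩ a

@[simp]
theorem monomialField_apply (K : Set E) (k : ℕ) (a : E) (x : K) :
    monomialField K k a x = inner ℝ a (x : E) ^ k • a := rfl

theorem monomialField_smul (K : Set E) (k : ℕ) (l : ℝ) (a : E) :
    monomialField K k (l • a) = l ^ (k + 1) • monomialField K k a := by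
  ext x
  simp only [monomialField_apply, ContinuousMap.smul_apply, inner_smul_left, smul_smul]
  congr 1
  simp only [conj_trivial]
  ring

/-- Taylor's formula with a remainder that is uniform on a compact set after rescaling. -/
theorem exists_nat_pow_mul_taylor_remainder_le {f : ℝ → ℝ} (hf : ContDiff ℝ ∞ f) (β R : ℝ) (k : ℕ)
    {η : ℝ} (hη : 0 < η) : ∃ n : ℕ, 0 < n ∧ ∀ t : ℝ, |t| ≤ R →
      |(n : ℝ) ^ k * (f (β + t / n) -
        ∑ j ∈ Finset.range (k + 1), iteratedDeriv j f β / j.factorial * (t / n) ^ j)| ≤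
      η * R ^ k := by
  have ho := (taylor_isLittleO_univ (x₀ := β) (n := k) (hf.of_le (by exact_mod_cast le_top))).def hη
  obtain ⟨r, hr, hball⟩ := Metric.eventually_nhds_iff.1 ho
  obtain ⟨n, hn⟩ := exists_nat_gt (max (R / r) 0)
  have hn0 : (0 : ℝ) < n := (le_max_right _ _).trans_lt hn
  refine ⟨n, by exact_mod_cast hn0, fun t ht => ?_⟩
  have hdist : dist (β + t / n) β < r := by
    rw [Real.dist_eq, add_sub_cancel_left, abs_div, abs_of_pos hn0, div_lt_iff₀ hn0]
    have := (le_max_left _ _).trans_lt hn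
    rw [div_lt_iff₀ hr] at this
    linarith
  have := hball hdist
  rw [taylor_within_apply] at this
  simp only [iteratedDerivWithin_univ, add_sub_cancel_left, smul_eq_mul, Real.norm_eq_abs,
    abs_pow, abs_div, abs_of_pos hn0] at this
  rw [abs_mul, abs_of_pos (pow_pos hn0 k)]
  have hsum : ∑ j ∈ Finset.range (k + 1), iteratedDeriv j f β / j.factorial * (t / n) ^ j =
      ∑ j ∈ Finset.range (k + 1), ((j.factorial : ℝ)⁻¹ * (t / n) ^ j) * iteratedDeriv j f β :=
    Finset.sum_congr rfl fun j _ => by ring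
  rw [hsum]
  calc (n : ℝ) ^ k * _ ≤ (n : ℝ) ^ k * (η * (|t| / n) ^ k) :=
        mul_le_mul_of_nonneg_left this (by positivity)
    _ = η * |t| ^ k := by
        rw [div_pow]
        field_simp
    _ ≤ η * R ^ k := by gcongr

/-- If a closed additive semigroup of fields on a compact set contains the ridge fields
`s f(⟨a, x⟩ + β) a`, then it contains the real multiples of the fields `⟨a, x⟩ ^ k a`, as soon as
every number is of the form `s l ^ (k + 1) f⁽ᵏ⁾(β)`. By Taylor's formula, the sum of `n ^ (k + 1)`
copies of the ridge field of `a / n` is the multiple `s f⁽ᵏ⁾(β) / k!` of the field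
`⟨a, x⟩ ^ k a`, up to fields of lower degree, which the semigroup can cancel, and to an error that
vanishes for large `n`. -/
theorem smul_monomialField_mem (K : Set E) [CompactSpace K] (S : AddSubmonoid C(K, E))
    (hS : IsClosed (S : Set C(K, E))) {f : C(ℝ, ℝ)} (hf : ContDiff ℝ ∞ f) (sgn : Set ℝ)
    (hridge : ∀ s ∈ sgn, ∀ (β : ℝ) (a : E),
      s • ridgeField K (f.comp ⟨fun t => β + t, by fun_prop⟩) a ∈ S)
    (hcoef : ∀ (k : ℕ) (c : ℝ), ∃ s ∈ sgn, ∃ β l : ℝ,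
      s * l ^ (k + 1) * iteratedDeriv k f β = c)
    (k : ℕ) (c : ℝ) (a : E) : c • monomialField K k a ∈ S := by
  induction k using Nat.strong_induction_on generalizing c a with
  | _ k ih =>
  obtain ⟨R₀, hR₀⟩ := (isCompact_iff_compactSpace.2 ‹CompactSpace K›).isBounded.exists_norm_le
  -- the factor `k!` cancels the one in Taylor's formula
  obtain ⟨s, hs, β, l, hc⟩ := hcoef k (k.factorial * c)
  set b := l • a with hb
  have hkey : c • monomialField K k a =
      (s * (iteratedDeriv k f β / k.factorial)) • monomialField K k b := by
    rw [hb, monomialField_smul, smul_smul]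
    congr 1
    have : (k.factorial : ℝ) ≠ 0 := by positivity
    field_simp
    linarith
  rw [hkey, ← SetLike.mem_coe, ← hS.closure_eq, Metric.mem_closure_iff]
  intro η hη
  set R := ‖b‖ * |R₀| with hR
  have hRx : ∀ x : K, |inner ℝ b (x : E)| ≤ R := fun x =>
    (abs_real_inner_le_norm _ _).trans
      (mul_le_mul_of_nonneg_left ((hR₀ x x.2).trans (le_abs_self _)) (norm_nonneg b))
  -- the total error is at most `|s| R ^ k ‖b‖` times that of the Taylor expansion
  have hD : 0 < |s| * R ^ k * ‖b‖ + 1 := by positivity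
  obtain ⟨n, hn, hrem⟩ := exists_nat_pow_mul_taylor_remainder_le hf β R k
    (half_pos (div_pos hη hD))
  have hn0 : (n : ℝ) ≠ 0 := by exact_mod_cast hn.ne'
  refine ⟨n ^ (k + 1) • (s • ridgeField K (f.comp ⟨fun t => β + t, by fun_prop⟩) ((n : ℝ)⁻¹ • b)) +
      ∑ j ∈ Finset.range k,
        (-(s * n ^ k * (iteratedDeriv j f β / j.factorial / n ^ j))) • monomialField K j b,
    S.add_mem (S.nsmul_mem (hridge s hs β _) _)
      (S.sum_mem fun j hj => ih j (Finset.mem_range.1 hj) _ b), ?_⟩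
  refine lt_of_le_of_lt ((ContinuousMap.dist_le (C := η / 2) (half_pos hη).le).2 fun x => ?_)
    (half_lt_self hη)
  set t := inner ℝ b (x : E) with ht
  have hexp : (s * (iteratedDeriv k f β / k.factorial)) • monomialField K k b x -
      (n ^ (k + 1) • (s • ridgeField K (f.comp ⟨fun t => β + t, by fun_prop⟩) ((n : ℝ)⁻¹ • b)) +
      ∑ j ∈ Finset.range k,
        (-(s * n ^ k * (iteratedDeriv j f β / j.factorial / n ^ j))) • monomialField K j b) x =
      (-(s * (n ^ k * (f (β + t / n) -
        ∑ j ∈ Finset.range (k + 1), iteratedDeriv j f β / j.factorial * (t / n) ^ j)))) • b := by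
    simp only [ContinuousMap.add_apply, ContinuousMap.smul_apply, ContinuousMap.sum_apply,
      ridgeField_apply, monomialField_apply, ContinuousMap.comp_apply, ContinuousMap.coe_mk,
      inner_smul_left, conj_trivial, smul_smul, ← ht, ← Nat.cast_smul_eq_nsmul ℝ, ← Finset.sum_smul,
      ← add_smul, ← sub_smul]
    congr 1
    have h1 : (n : ℝ)⁻¹ * t = t / n := by ring
    have h2 : ∑ j ∈ Finset.range k,
        -(s * n ^ k * (iteratedDeriv j f β / j.factorial / n ^ j)) * t ^ j =
        -(s * n ^ k * ∑ j ∈ Finset.range k, iteratedDeriv j f β / j.factorial * (t / n) ^ j) := by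
      rw [Finset.mul_sum, ← Finset.sum_neg_distrib]
      exact Finset.sum_congr rfl fun j _ => by rw [div_pow]; ring
    rw [h1, h2, Finset.sum_range_succ]
    push_cast
    rw [div_pow t (n : ℝ) k]
    field_simp
    ring
  rw [dist_eq_norm, ContinuousMap.smul_apply, hexp, norm_smul, norm_neg, norm_mul, Real.norm_eq_abs,
    Real.norm_eq_abs]
  have hr := hrem t (hRx x)
  calc _ ≤ |s| * (η / (|s| * R ^ k * ‖b‖ + 1) / 2 * R ^ k) * ‖b‖ := by gcongr
    _ = η / 2 * ((|s| * R ^ k * ‖b‖) / (|s| * R ^ k * ‖b‖ + 1)) := by field_simp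
    _ ≤ η / 2 * 1 := by
        gcongr
        rw [div_le_one hD]
        linarith
    _ = η / 2 := mul_one _

end Ridge

/-! ### Density of polynomial gradients -/

section Density

open MeasureTheory

open scoped FourierTransform SchwartzMap

variable {E : Type*} [NormedAddCommGroup E] [InnerProductSpace ℝ E]

/-- By the Weierstrass approximation theorem for the profile `φ`. -/
theorem ridgeField_mem (K : Set E) [CompactSpace K] (V : Submodule ℝ C(K, E))
    (hV : IsClosed (V : Set C(K, E))) (hmon : ∀ k a, monomialField K k a ∈ V) (φ : C(ℝ, ℝ))
    (a : E) : ridgeField K φ a ∈ V := by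
  obtain ⟨R₀, hR₀⟩ := (isCompact_iff_compactSpace.2 ‹CompactSpace K›).isBounded.exists_norm_le
  rw [← SetLike.mem_coe, ← hV.closure_eq, Metric.mem_closure_iff]
  intro η hη
  set R := ‖a‖ * |R₀| with hR
  have hD : 0 < ‖a‖ + 1 := by positivity
  obtain ⟨p, hp⟩ := exists_polynomial_near_of_continuousOn (-R) R φ φ.continuous.continuousOn
    (η / 2 / (‖a‖ + 1)) (by positivity)
  refine ⟨∑ k ∈ p.support, p.coeff k • monomialField K k a,
    V.sum_mem fun k _ => V.smul_mem _ (hmon k a), ?_⟩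
  refine lt_of_le_of_lt ((ContinuousMap.dist_le (C := η / 2) (half_pos hη).le).2 fun x => ?_)
    (half_lt_self hη)
  have hx : inner ℝ a (x : E) ∈ Icc (-R) R := abs_le.1 <|
    (abs_real_inner_le_norm _ _).trans
      (mul_le_mul_of_nonneg_left ((hR₀ x x.2).trans (le_abs_self _)) (norm_nonneg a))
  have hval : (∑ k ∈ p.support, p.coeff k • monomialField K k a) x =
      p.eval (inner ℝ a (x : E)) • a := by
    rw [Polynomial.eval_eq_sum, Polynomial.sum, Finset.sum_smul]
    simp [smul_smul]
  rw [hval, ridgeField_apply, dist_comm, dist_eq_norm, ← sub_smul, norm_smul, Real.norm_eq_abs]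
  calc _ ≤ η / 2 / (‖a‖ + 1) * ‖a‖ := by
        gcongr
        exact (hp _ hx).le
    _ = η / 2 * (‖a‖ / (‖a‖ + 1)) := by ring
    _ ≤ η / 2 * 1 := by
        gcongr
        rw [div_le_one hD]
        linarith
    _ = η / 2 := mul_one _

theorem integral_mem_of_isClosed {α G : Type*} [MeasurableSpace α] {μ : Measure α}
    [NormedAddCommGroup G] [NormedSpace ℝ G] [CompleteSpace G] (V : Submodule ℝ G)
    (hV : IsClosed (V : Set G)) {Φ : α → G} (hΦ : Integrable Φ μ) (hmem : ∀ ξ, Φ ξ ∈ V) :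
    ∫ ξ, Φ ξ ∂μ ∈ V := by
  by_contra h
  obtain ⟨l, u, h1, h2⟩ := geometric_hahn_banach_point_closed V.convex hV h
  -- a functional that is bounded below on a subspace vanishes on it
  have hzero : ∀ v ∈ V, l v = 0 := by
    intro v hv
    by_contra hlv
    have := h2 (((u - 1) / l v) • v) (V.smul_mem _ hv)
    rw [map_smul, smul_eq_mul, div_mul_cancel₀ _ hlv] at this
    linarith
  have h0 := h2 0 V.zero_mem
  rw [← l.integral_comp_comm hΦ] at h1
  simp only [hzero _ (hmem _), integral_zero, map_zero] at h1 h0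
  exact lt_asymm h0 h1

/-- The profile `t ↦ Re (2πi w e^{2πit})`. The ridge fields with these profiles, for `w` the Fourier
transform of a function at the frequency `a`, are the integrands of the Fourier inversion formula
for its gradient. -/
noncomputable def fourierProfile (w : ℂ) : C(ℝ, ℝ) :=
  ⟨fun t => (𝐞 t • (2 * Real.pi * Complex.I * w)).re, by fun_prop⟩

theorem fourierProfile_apply (w : ℂ) (t : ℝ) :
    fourierProfile w t = (𝐞 t • (2 * Real.pi * Complex.I * w)).re := rfl

theorem abs_fourierProfile_le (w : ℂ) (t : ℝ) : |fourierProfile w t| ≤ 2 * Real.pi * ‖w‖ := by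
  refine (Complex.abs_re_le_norm _).trans (le_of_eq ?_)
  simp [Circle.norm_smul, abs_of_pos Real.pi_pos]

theorem norm_ridgeField_fourierProfile_le (K : Set E) [CompactSpace K] (w : ℂ) (a : E) :
    ‖ridgeField K (fourierProfile w) a‖ ≤ 2 * Real.pi * (‖a‖ * ‖w‖) := by
  refine (ContinuousMap.norm_le _ (by positivity)).2 fun x => ?_
  rw [ridgeField_apply, norm_smul, Real.norm_eq_abs]
  calc _ ≤ 2 * Real.pi * ‖w‖ * ‖a‖ := by
        gcongr
        exact abs_fourierProfile_le _ _
    _ = _ := by ring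

variable [FiniteDimensional ℝ E] [MeasurableSpace E] [BorelSpace E]

theorem integrable_ridgeField_fourierProfile (K : Set E) [CompactSpace K] (g : 𝓢(E, ℂ)) :
    Integrable fun ξ => ridgeField K (fourierProfile (g ξ)) ξ := by
  have hcont : Continuous fun ξ => ridgeField K (fourierProfile (g ξ)) ξ := by
    refine ContinuousMap.continuous_of_continuous_uncurry _ ?_
    have hg := g.continuous
    simp only [Function.uncurry_def, ridgeField_apply, fourierProfile_apply]
    fun_prop
  refine Integrable.mono' ((g.integrable_pow_mul volume 1).const_mul (2 * Real.pi))
    hcont.aestronglyMeasurable (Eventually.of_forall fun ξ => ?_)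
  simpa using norm_ridgeField_fourierProfile_le K (g ξ) ξ

theorem fderiv_eq_integral_fourierProfile (g : 𝓢(E, ℂ)) (x m : E) :
    (fderiv ℝ g x m).re = ∫ ξ, fourierProfile ((𝓕 g) ξ) (inner ℝ ξ x) * inner ℝ ξ m := by
  have h1 : LineDeriv.lineDerivOp m g =
      𝓕⁻ ((2 * Real.pi * Complex.I) • SchwartzMap.smulLeftCLM ℂ (fun ξ => inner ℝ ξ m) (𝓕 g)) := by
    rw [← SchwartzMap.fourier_lineDerivOp_eq, FourierTransform.fourierInv_fourier_eq]
  have htemp : (fun ξ : E => inner ℝ ξ m).HasTemperateGrowth :=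
    ((innerSL ℝ).flip m).hasTemperateGrowth
  set G := (2 * Real.pi * Complex.I) • SchwartzMap.smulLeftCLM ℂ (fun ξ => inner ℝ ξ m) (𝓕 g) with hG
  have hint : Integrable fun ξ => 𝐞 (inner ℝ ξ x) • G ξ := by
    refine Integrable.mono' G.integrable.norm ?_ (Eventually.of_forall fun ξ => by
      rw [Circle.norm_smul])
    have := G.continuous
    exact Continuous.aestronglyMeasurable (by fun_prop)
  rw [← SchwartzMap.lineDerivOp_apply_eq_fderiv, h1, SchwartzMap.fourierInv_coe,
    Real.fourierInv_eq, ← Complex.reCLM_apply, ← Complex.reCLM.integral_comp_comm hint]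
  congr 1
  ext ξ
  rw [hG, smul_apply, SchwartzMap.smulLeftCLM_apply_apply htemp, fourierProfile_apply]
  have h2 : 𝐞 (inner ℝ ξ x) • (2 * Real.pi * Complex.I) • inner ℝ ξ m • (𝓕 g) ξ =
      (inner ℝ ξ m) • (𝐞 (inner ℝ ξ x) • (2 * Real.pi * Complex.I * (𝓕 g) ξ)) := by
    simp only [Circle.smul_def, smul_eq_mul, Complex.real_smul]
    ring
  rw [h2, Complex.reCLM_apply, Complex.smul_re, smul_eq_mul, mul_comm]

/-- A closed subspace of fields that contains the gradients of the powers of linear functionals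
contains the gradients of all smooth functions of compact support: by Fourier inversion, such a
gradient is an integral of ridge fields. -/
theorem gradient_mem (K : Set E) [CompactSpace K] (V : Submodule ℝ C(K, E))
    (hV : IsClosed (V : Set C(K, E))) (hmon : ∀ k a, monomialField K k a ∈ V) {h : E → ℝ}
    (hh : ContDiff ℝ ∞ h) (hsupp : HasCompactSupport h) :
    ∃ F ∈ V, ∀ x : K, F x = gradient h x := by
  obtain ⟨g, hgh⟩ : ∃ g : 𝓢(E, ℂ), ⇑g = fun x => (h x : ℂ) :=
    ⟨HasCompactSupport.toSchwartzMap (f := fun x => (h x : ℂ))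
      (hsupp.comp_left (g := fun t : ℝ => (t : ℂ)) Complex.ofReal_zero)
      (Complex.ofRealCLM.contDiff.comp hh), rfl⟩
  obtain ⟨G, hG⟩ : ∃ G : 𝓢(E, ℂ), ∀ x m, (fderiv ℝ g x m).re =
      ∫ ξ, fourierProfile (G ξ) (inner ℝ ξ x) * inner ℝ ξ m :=
    ⟨_, fderiv_eq_integral_fourierProfile g⟩
  have hint := integrable_ridgeField_fourierProfile K G
  have hmem : ∀ ξ, ridgeField K (fourierProfile (G ξ)) ξ ∈ V :=
    fun ξ => ridgeField_mem K V hV hmon (fourierProfile (G ξ)) ξ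
  have hmem' := integral_mem_of_isClosed V hV hint hmem
  refine ⟨_, hmem', fun x => ?_⟩
  rw [ContinuousMap.integral_apply hint]
  refine ext_inner_left ℝ fun m => ?_
  have hintx : Integrable fun ξ => ridgeField K (fourierProfile (G ξ)) ξ x :=
    (ContinuousMap.evalCLM ℝ x).integrable_comp hint
  have hder : fderiv ℝ (fun x => (h x : ℂ)) x m = (fderiv ℝ h x m : ℂ) := by
    have := (Complex.ofRealCLM.hasFDerivAt (x := h x)).comp (x : E)
      (hh.differentiable (by simp) (x : E)).hasFDerivAt
    exact congrArg (fun L => L m) this.fderiv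
  have hgrad : inner ℝ m (gradient h (x : E)) = fderiv ℝ h x m := by
    rw [real_inner_comm, gradient, InnerProductSpace.toDual_symm_apply]
  rw [hgrad, ← integral_inner hintx, ← Complex.ofReal_re (fderiv ℝ h x m), ← hder, ← hgh,
    hG]
  refine integral_congr_ae (Eventually.of_forall fun ξ => ?_)
  simp only [ridgeField_apply]
  rw [inner_smul_right, real_inner_comm m ξ]

end Density

/-! ### Density of the gradients of sums of neurons -/

section Approximation

variable {𝔤 : Type*} [LieRing 𝔤] [LieAlgebra ℝ 𝔤] {N n : ℕ}

/-- The coordinate vector of `α ∈ 𝔤^N`, with which the duality pairing is an inner product. -/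
noncomputable def coordVec (X : Module.Basis (Fin n) ℝ 𝔤) (α : Fin N → 𝔤) : PhaseSpace N n :=
  WithLp.toLp 2 fun p => X.repr (α p.1) p.2

theorem pairing_eq_inner (X : Module.Basis (Fin n) ℝ 𝔤) (α : Fin N → 𝔤) (μ : PhaseSpace N n) :
    pairing X α μ = inner ℝ (coordVec X α) μ := by
  rw [pairing, PiLp.inner_apply, Fintype.sum_prod_type]
  refine Finset.sum_congr rfl fun k _ => Finset.sum_congr rfl fun i _ => ?_
  simp [coordVec, mul_comm]

theorem exists_coordVec_eq (X : Module.Basis (Fin n) ℝ 𝔤) (a : PhaseSpace N n) :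
    ∃ α : Fin N → 𝔤, coordVec X α = a := by
  refine ⟨fun k => X.equivFun.symm fun i => a (k, i), ?_⟩
  ext p
  simp only [coordVec]
  rw [← X.equivFun_apply, LinearEquiv.apply_symm_apply]

theorem contDiff_hApprox (X : Module.Basis (Fin n) ℝ 𝔤) {σ : ℝ → ℝ} (hσ : ContDiff ℝ ∞ σ) {M : ℕ}
    (s : Fin M → ℝ) (α : Fin M → Fin N → 𝔤) (β : Fin M → ℝ) :
    ContDiff ℝ ∞ (hApprox X σ s α β) := by
  unfold hApprox
  simp only [pairing_eq_inner]
  exact ContDiff.sum fun j _ => contDiff_const.mul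
    (hσ.comp ((innerSL ℝ (coordVec X (α j))).contDiff.add contDiff_const))

theorem hasGradientAt_neuron (X : Module.Basis (Fin n) ℝ 𝔤) {σ : ℝ → ℝ} (hσ : ContDiff ℝ ∞ σ)
    (s : ℝ) (α : Fin N → 𝔤) (β : ℝ) (μ : PhaseSpace N n) :
    HasGradientAt (fun μ => s * σ (pairing X α μ + β))
      (s • deriv σ (β + inner ℝ (coordVec X α) μ) • coordVec X α) μ := by
  rw [hasGradientAt_iff_hasFDerivAt]
  simp only [pairing_eq_inner]
  have h1 : HasFDerivAt (fun μ => inner ℝ (coordVec X α) μ + β) (innerSL ℝ (coordVec X α)) μ :=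
    (innerSL ℝ (coordVec X α)).hasFDerivAt.add_const β
  have h2 := (hσ.differentiable (by simp) (inner ℝ (coordVec X α) μ + β)).hasDerivAt
  have h3 := (h2.comp_hasFDerivAt μ h1).const_mul s
  refine h3.congr_fderiv ?_
  ext v
  simp [add_comm β]

theorem hApprox_one (X : Module.Basis (Fin n) ℝ 𝔤) (σ : ℝ → ℝ) (s : ℝ) (α : Fin N → 𝔤) (β : ℝ) :
    hApprox (M := 1) X σ (fun _ => s) (fun _ => α) (fun _ => β) =
      fun μ => s * σ (pairing X α μ + β) := by
  ext μ
  simp [hApprox]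

theorem hApprox_append (X : Module.Basis (Fin n) ℝ 𝔤) (σ : ℝ → ℝ) {M M' : ℕ}
    (s : Fin M → ℝ) (α : Fin M → Fin N → 𝔤) (β : Fin M → ℝ)
    (s' : Fin M' → ℝ) (α' : Fin M' → Fin N → 𝔤) (β' : Fin M' → ℝ) :
    hApprox X σ (Fin.append s s') (Fin.append α α') (Fin.append β β') =
      hApprox X σ s α β + hApprox X σ s' α' β' := by
  ext μ
  simp [hApprox, Fin.sum_univ_add]

/-- The admissible signs: `-1` is allowed for unbounded `σ` only. -/
def signSet (σ : ℝ → ℝ) : Set ℝ :=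
  {s | s = 1 ∨ s = -1 ∧ ¬ ∃ C, ∀ ξ, |σ ξ| ≤ C}

/-- The additive semigroup of the gradients, restricted to `U`, of the Hamiltonians
`∑ j, s_j σ(⟨α_j, μ⟩ + β_j)` with admissible signs. -/
def gradientSubmonoid (X : Module.Basis (Fin n) ℝ 𝔤) {σ : ℝ → ℝ} (hσ : ContDiff ℝ ∞ σ)
    (U : Set (PhaseSpace N n)) : AddSubmonoid C(U, PhaseSpace N n) where
  carrier := {F | ∃ (M : ℕ) (s : Fin M → ℝ) (α : Fin M → Fin N → 𝔤) (β : Fin M → ℝ),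
    0 < M ∧ (∀ j, s j ∈ signSet σ) ∧ ∀ μ : U, F μ = gradient (hApprox X σ s α β) μ}
  zero_mem' := by
    refine ⟨1, fun _ => 1, fun _ => 0, fun _ => 0, one_pos, fun _ => Or.inl rfl, fun μ => ?_⟩
    have h0 : coordVec X (0 : Fin N → 𝔤) = 0 := by
      ext p
      simp [coordVec]
    rw [hApprox_one, (hasGradientAt_neuron X hσ 1 0 0 (μ : PhaseSpace N n)).gradient, h0]
    simp
  add_mem' := by
    rintro F F' ⟨M, s, α, β, hM, hs, hF⟩ ⟨M', s', α', β', hM', hs', hF'⟩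
    refine ⟨M + M', Fin.append s s', Fin.append α α', Fin.append β β', by omega, ?_, fun μ => ?_⟩
    · intro j
      induction j using Fin.addCases with
      | left j => simpa using hs j
      | right j => simpa using hs' j
    · rw [hApprox_append, ContinuousMap.add_apply, hF, hF', gradient, gradient, gradient,
        fderiv_add ((contDiff_hApprox X hσ s α β).differentiable (by simp) _)
          ((contDiff_hApprox X hσ s' α' β').differentiable (by simp) _), map_add]

theorem smul_ridgeField_mem_gradientSubmonoid (X : Module.Basis (Fin n) ℝ 𝔤) {σ : ℝ → ℝ}
    (hσ : ContDiff ℝ ∞ σ) (U : Set (PhaseSpace N n)) {f : C(ℝ, ℝ)} (hf : ⇑f = deriv σ) {s : ℝ}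
    (hs : s ∈ signSet σ) (β : ℝ) (a : PhaseSpace N n) :
    s • ridgeField U (f.comp ⟨fun t => β + t, by fun_prop⟩) a ∈ gradientSubmonoid X hσ U := by
  obtain ⟨α, rfl⟩ := exists_coordVec_eq X a
  refine ⟨1, fun _ => s, fun _ => α, fun _ => β, one_pos, fun _ => hs, fun μ => ?_⟩
  rw [hApprox_one, (hasGradientAt_neuron X hσ s α β (μ : PhaseSpace N n)).gradient]
  simp [hf]

/-- The gradient of a smooth function of compact support is uniformly approximated on a compact set
by gradients of the Hamiltonians `∑ j, s_j σ(⟨α_j, μ⟩ + β_j)` with admissible signs. -/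
theorem exists_hApprox_gradient_near (X : Module.Basis (Fin n) ℝ 𝔤) {σ : ℝ → ℝ}
    (hσ : ContDiff ℝ ∞ σ) (hpoly : ¬ ∃ p : Polynomial ℝ, ∀ ξ, σ ξ = p.eval ξ)
    {h : PhaseSpace N n → ℝ} (hh : ContDiff ℝ ∞ h) (hsupp : HasCompactSupport h)
    {U : Set (PhaseSpace N n)} (hU : IsCompact U) {δ : ℝ} (hδ : 0 < δ) :
    ∃ (M : ℕ) (s : Fin M → ℝ) (α : Fin M → Fin N → 𝔤) (β : Fin M → ℝ),
      0 < M ∧ (∀ j, s j ∈ signSet σ) ∧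
      ∀ μ ∈ U, ‖gradient (hApprox X σ s α β) μ - gradient h μ‖ < δ := by
  have : CompactSpace U := isCompact_iff_compactSpace.1 hU
  have hd : ContDiff ℝ ∞ (deriv σ) := (contDiff_infty_iff_deriv.1 hσ).2
  set f : C(ℝ, ℝ) := ⟨deriv σ, hd.continuous⟩ with hf
  set S := (gradientSubmonoid X hσ U).topologicalClosure with hS
  have hSc : IsClosed (S : Set C(U, PhaseSpace N n)) :=
    AddSubmonoid.isClosed_topologicalClosure _
  have hmon : ∀ (k : ℕ) (c : ℝ) (a : PhaseSpace N n), c • monomialField U k a ∈ S := by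
    refine smul_monomialField_mem U S hSc (f := f) hd (signSet σ) (fun s hs β a => ?_)
      (fun k c => ?_)
    · exact AddSubmonoid.le_topologicalClosure _
        (smul_ridgeField_mem_gradientSubmonoid X hσ U rfl hs β a)
    · obtain ⟨s, β, l, hs, hc⟩ := exists_sign_mul_pow_mul_iteratedDeriv_eq hσ hpoly k c
      refine ⟨s, hs, β, l, ?_⟩
      rw [iteratedDeriv_succ'] at hc
      exact hc
  set V₀ : Submodule ℝ C(U, PhaseSpace N n) :=
    Submodule.span ℝ {F | ∃ k a, F = monomialField U k a} with hV₀
  have hV₀S : (V₀ : Set C(U, PhaseSpace N n)) ⊆ S := by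
    intro F hF
    suffices ∀ c : ℝ, c • F ∈ S by simpa using this 1
    induction hF using Submodule.span_induction with
    | mem F hF =>
      obtain ⟨k, a, rfl⟩ := hF
      exact fun c => hmon k c a
    | zero => exact fun c => by simp
    | add F G _ _ hF hG =>
      intro c
      rw [smul_add c F G]
      exact S.add_mem (hF c) (hG c)
    | smul d F _ hF => exact fun c => by simpa only [smul_smul] using hF (c * d)
  obtain ⟨F, hFV, hF⟩ := gradient_mem U V₀.topologicalClosure V₀.isClosed_topologicalClosure
    (fun k a => V₀.le_topologicalClosure (Submodule.subset_span ⟨k, a, rfl⟩)) hh hsupp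
  have hFS : F ∈ closure (gradientSubmonoid X hσ U : Set C(U, PhaseSpace N n)) :=
    closure_minimal hV₀S hSc hFV
  obtain ⟨G, ⟨M, s, α, β, hM, hs, hG⟩, hdist⟩ := Metric.mem_closure_iff.1 hFS δ hδ
  refine ⟨M, s, α, β, hM, hs, fun μ hμ => ?_⟩
  rw [← hG ⟨μ, hμ⟩, ← hF ⟨μ, hμ⟩, ← dist_eq_norm, dist_comm]
  exact (ContinuousMap.dist_apply_le_dist (f := F) (g := G) ⟨μ, hμ⟩).trans_lt hdist

end Approximation

/-! ### Comparison of trajectories -/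

section Trajectories

variable {E : Type*} [NormedAddCommGroup E] [NormedSpace ℝ E]

/-- A ball around a point of `U` whose radius does not exceed the distance to the boundary of `U`
lies in `U`. -/
theorem ball_subset_of_lt_infEDist_frontier {U : Set E} {x : E} {ε : ℝ} (hx : x ∈ U)
    (hd : ENNReal.ofReal ε < Metric.infEDist x (frontier U)) : Metric.ball x ε ⊆ U := by
  intro z hz
  by_contra hzU
  have hε : 0 < ε := dist_nonneg.trans_lt (Metric.mem_ball.1 hz)
  obtain ⟨w, hw, hwU⟩ : ∃ w ∈ Metric.ball x ε, w ∈ frontier U := by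
    by_contra! hno
    have hcover : Metric.ball x ε ⊆ interior U ∪ (closure U)ᶜ := fun w hw => by
      by_cases hwU : w ∈ closure U
      · exact Or.inl (by_contra fun hwi => hno w hw ⟨hwU, hwi⟩)
      · exact Or.inr hwU
    have hxi : x ∈ interior U := (hcover (Metric.mem_ball_self hε)).resolve_right
      fun h => h (subset_closure hx)
    have hzc : z ∈ (closure U)ᶜ := (hcover hz).resolve_left fun h => hzU (interior_subset h)
    obtain ⟨w, -, hw1, hw2⟩ := (convex_ball x ε).isPreconnected _ _ isOpen_interior
      isClosed_closure.isOpen_compl hcover ⟨x, Metric.mem_ball_self hε, hxi⟩ ⟨z, hz, hzc⟩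
    exact hw2 (subset_closure (interior_subset hw1))
  have h1 := hd.trans_le (Metric.infEDist_le_edist_of_mem hwU)
  rw [edist_dist, ENNReal.ofReal_lt_ofReal_iff_of_nonneg hε.le, dist_comm] at h1
  exact lt_asymm h1 (Metric.mem_ball.1 hw)

/-- Grönwall's inequality up to the first exit: if `G` is `δ`-close to the Lipschitz field `F` on a
set that contains the `ε`-balls around a trajectory of `F`, then a trajectory of `G` with the same
initial value cannot reach the distance `ε` from it, provided that the Grönwall bound is below
`ε`. -/
theorem dist_lt_of_field_near {F G : E → E} {K : NNReal} (hF : LipschitzWith K F) {U : Set E}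
    {δ ε T τ : ℝ} (hδ : 0 ≤ δ) (hτ : τ ≤ T) (hbound : gronwallBound 0 K δ T < ε)
    (hFG : ∀ z ∈ U, dist (G z) (F z) ≤ δ) {x y : ℝ → E}
    (hx : ∀ t ∈ Ico 0 τ, HasDerivWithinAt x (F (x t)) (Ico 0 τ) t)
    (hy : ∀ t ∈ Ico 0 τ, HasDerivWithinAt y (G (y t)) (Ico 0 τ) t)
    (h0 : y 0 = x 0) (hball : ∀ t ∈ Ico 0 τ, Metric.ball (x t) ε ⊆ U) :
    ∀ t ∈ Ico 0 τ, dist (x t) (y t) < ε := by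
  intro t ht
  by_contra! hfar
  have hxc : ContinuousOn x (Ico 0 τ) := fun u hu => (hx u hu).continuousWithinAt
  have hyc : ContinuousOn y (Ico 0 τ) := fun u hu => (hy u hu).continuousWithinAt
  have hsub : Icc 0 t ⊆ Ico 0 τ := fun u hu => ⟨hu.1, hu.2.trans_lt ht.2⟩
  have hcl : IsClosed {u ∈ Icc 0 t | ε ≤ dist (x u) (y u)} :=
    isClosed_Icc.isClosed_le continuousOn_const (continuous_dist.comp_continuousOn
      ((hxc.mono hsub).prodMk (hyc.mono hsub)))
  obtain ⟨u, ⟨hu, hufar⟩, hmin⟩ :=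
    (isCompact_Icc.of_isClosed_subset hcl (fun u hu => hu.1)).exists_isLeast
      ⟨t, ⟨ht.1, le_rfl⟩, hfar⟩
  have hsubu : Icc 0 u ⊆ Ico 0 τ := fun v hv => hsub ⟨hv.1, hv.2.trans hu.2⟩
  have hright : ∀ v ∈ Ico 0 u, Ico 0 τ ∈ 𝓝[Ici v] v := by
    intro v hv
    refine mem_of_superset (Ico_mem_nhdsGE (hv.2.trans_le (hu.2.trans ht.2.le))) ?_
    exact Ico_subset_Ico_left hv.1
  have hgron := dist_le_of_approx_trajectories_ODE (v := fun _ => F) (K := K) (a := 0) (b := u)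
    (δ := 0) (εf := 0) (εg := δ) (fun _ => hF) (hxc.mono hsubu)
    (fun v hv => (hx v (hsubu (Ico_subset_Icc_self hv))).mono_of_mem_nhdsWithin (hright v hv))
    (fun v _ => (dist_self _).le) (hyc.mono hsubu)
    (fun v hv => (hy v (hsubu (Ico_subset_Icc_self hv))).mono_of_mem_nhdsWithin (hright v hv))
    (fun v hv => by
      -- before the first exit time the trajectory of `G` stays in `U`
      refine hFG _ (hball v (hsubu (Ico_subset_Icc_self hv)) ?_)
      rw [Metric.mem_ball, dist_comm]
      by_contra! hv'
      exact absurd (hmin ⟨⟨hv.1, hv.2.le.trans hu.2⟩, hv'⟩) (not_le.2 hv.2))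
    (by rw [h0, dist_self]) u ⟨hu.1, le_rfl⟩
  rw [zero_add, sub_zero] at hgron
  have hmono : gronwallBound 0 K δ u ≤ gronwallBound 0 K δ T :=
    gronwallBound_mono le_rfl hδ K.coe_nonneg (hu.2.trans (ht.2.le.trans hτ))
  linarith

/-- A bounded, globally Lipschitz field has trajectories on every interval `[0, T]`. -/
theorem exists_trajectory_of_lipschitz_of_bounded [CompleteSpace E] {G : E → E} {K : NNReal}
    (hG : LipschitzWith K G) {L : NNReal} (hL : ∀ z, ‖G z‖ ≤ L) (T : NNReal) (x₀ : E) :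
    ∃ y : ℝ → E, y 0 = x₀ ∧
      ∀ t ∈ Icc (0 : ℝ) T, HasDerivWithinAt y (G (y t)) (Icc 0 T) t := by
  -- a trajectory of speed at most `L` does not leave the ball of radius `L * T` in time `T`
  have hpl : IsPicardLindelof (fun _ => G) (⟨0, ⟨le_rfl, T.coe_nonneg⟩⟩ : Icc (0 : ℝ) T) x₀
      (L * T) 0 L K :=
    { lipschitzOnWith := fun _ _ => hG.lipschitzOnWith
      continuousOn := fun _ _ => continuousOn_const
      norm_le := fun _ _ z _ => hL z
      mul_max_le := by simp }
  exact hpl.exists_eq_forall_mem_Icc_hasDerivWithinAt₀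

end Trajectories

/-! ### Regularity of the Hamiltonian vector field -/

section Field

variable {𝔤 : Type*} [LieRing 𝔤] [LieAlgebra ℝ 𝔤] {N n : ℕ}

theorem poissonTensor_add (X : Module.Basis (Fin n) ℝ 𝔤) (μ ν : PhaseSpace N n) :
    poissonTensor X (μ + ν) = poissonTensor X μ + poissonTensor X ν := by
  ext p q
  by_cases hpq : p.1 = q.1
  · simp [poissonTensor, muHat, hpq, Matrix.sum_apply, add_mul, Finset.sum_add_distrib]
    ring
  · simp [poissonTensor, hpq]

theorem poissonTensor_smul (X : Module.Basis (Fin n) ℝ 𝔤) (c : ℝ) (μ : PhaseSpace N n) :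
    poissonTensor X (c • μ) = c • poissonTensor X μ := by
  ext p q
  by_cases hpq : p.1 = q.1
  · simp [poissonTensor, muHat, hpq, Matrix.sum_apply, mul_assoc, ← Finset.mul_sum]
    ring
  · simp [poissonTensor, hpq]

/-- The Poisson tensor as a continuous bilinear map `(μ, v) ↦ Λ(μ) v`. -/
noncomputable def poissonCLM (X : Module.Basis (Fin n) ℝ 𝔤) (N : ℕ) :
    PhaseSpace N n →L[ℝ] PhaseSpace N n →L[ℝ] PhaseSpace N n :=
  LinearMap.toContinuousLinearMap
    { toFun := fun μ => Matrix.toEuclideanCLM (𝕜 := ℝ) (poissonTensor X μ)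
      map_add' := fun μ ν => by rw [poissonTensor_add, map_add]
      map_smul' := fun c μ => by rw [poissonTensor_smul, map_smul, RingHom.id_apply] }

theorem hamiltonianField_eq (X : Module.Basis (Fin n) ℝ 𝔤) (h : PhaseSpace N n → ℝ)
    (μ : PhaseSpace N n) : hamiltonianField X h μ = poissonCLM X N μ (gradient h μ) := rfl

theorem contDiff_hamiltonianField (X : Module.Basis (Fin n) ℝ 𝔤) {h : PhaseSpace N n → ℝ}
    (hh : ContDiff ℝ ∞ h) : ContDiff ℝ ∞ (hamiltonianField X h) := by
  have hgrad : ContDiff ℝ ∞ (gradient h) :=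
    (InnerProductSpace.toDual ℝ (PhaseSpace N n)).symm.contDiff.comp
      (contDiff_infty_iff_fderiv.1 hh).2
  exact (poissonCLM X N).contDiff.clm_apply hgrad

theorem hasCompactSupport_hamiltonianField (X : Module.Basis (Fin n) ℝ 𝔤)
    {h : PhaseSpace N n → ℝ} (hh : HasCompactSupport h) :
    HasCompactSupport (hamiltonianField X h) := by
  refine (hh.fderiv ℝ).mono fun μ hμ => ?_
  contrapose! hμ
  rw [Function.notMem_support] at hμ ⊢
  rw [hamiltonianField_eq, gradient, hμ, map_zero, map_zero]

theorem dist_hamiltonianField_le (X : Module.Basis (Fin n) ℝ 𝔤) (h₁ h₂ : PhaseSpace N n → ℝ)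
    (μ : PhaseSpace N n) : dist (hamiltonianField X h₁ μ) (hamiltonianField X h₂ μ) ≤
      ‖poissonCLM X N‖ * ‖μ‖ * ‖gradient h₁ μ - gradient h₂ μ‖ := by
  rw [hamiltonianField_eq, hamiltonianField_eq, dist_eq_norm, ← map_sub]
  exact (poissonCLM X N).le_opNorm₂ μ _

theorem gradient_congr_of_eventuallyEq {h₁ h₂ : PhaseSpace N n → ℝ} {μ : PhaseSpace N n}
    (h : h₁ =ᶠ[𝓝 μ] h₂) : gradient h₁ μ = gradient h₂ μ := by
  rw [gradient, gradient, h.fderiv_eq]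

end Field

/-! ### Approximation of the flow -/

theorem exists_pos_gronwallBound_lt (K T : ℝ) {ε : ℝ} (hε : 0 < ε) :
    ∃ δ, 0 < δ ∧ gronwallBound 0 K δ T < ε := by
  have h0 : ∀ᶠ δ in 𝓝 (0 : ℝ), gronwallBound 0 K δ T < ε :=
    (gronwallBound_continuous_ε 0 K T).continuousAt.eventually_lt continuousAt_const
      (by simpa [gronwallBound_ε0_δ0] using hε)
  obtain ⟨δ, hδ, hpos⟩ := ((h0.filter_mono nhdsWithin_le_nhds).and
    (self_mem_nhdsWithin (s := Ioi 0))).exists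
  exact ⟨δ, hpos, hδ⟩

theorem exists_contDiffBump_eventuallyEq_one {N n : ℕ} {U : Set (PhaseSpace N n)}
    (hU : IsCompact U) : ∃ χ : ContDiffBump (0 : PhaseSpace N n), ∀ z ∈ U, χ =ᶠ[𝓝 z] 1 := by
  obtain ⟨R, hR, hUR⟩ := hU.isBounded.subset_ball_lt 0 0
  exact ⟨⟨R, R + 1, hR, by linarith⟩, fun z hz =>
    ContDiffBump.eventuallyEq_one_of_mem_ball _ (hUR hz)⟩

end LiePoisson

open LiePoisson Set in
theorem mainTheorem2 {𝔤 : Type*} [LieRing 𝔤] [LieAlgebra ℝ 𝔤] {N n : ℕ}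
    (X : Module.Basis (Fin n) ℝ 𝔤)
    (σ : ℝ → ℝ) (hσ_smooth : ContDiff ℝ ∞ σ) (hσ_mono : Monotone σ)
    (hσ_not_poly : ¬ ∃ p : Polynomial ℝ, ∀ ξ, σ ξ = p.eval ξ)
    (h : LiePoisson.PhaseSpace N n → ℝ) (hh : ContDiff ℝ ∞ h)
    (U : Set (LiePoisson.PhaseSpace N n)) (hU : IsCompact U)
    (T : ℝ) (hT : 0 < T) (ε : ℝ) (hε : 0 < ε) :
    ∃ (M : ℕ) (s : Fin M → ℝ) (α : Fin M → Fin N → 𝔤) (β : Fin M → ℝ),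
      0 < M ∧
      (∀ j, s j = 1 ∨ s j = -1) ∧
      ((∃ C, ∀ ξ, |σ ξ| ≤ C) → ∀ j, s j = 1) ∧
      ∀ (τ : ℝ) (x : ℝ → LiePoisson.PhaseSpace N n), 0 < τ → τ ≤ T →
        LiePoisson.IsSolutionOn X h τ x →
        (∀ t ∈ Set.Ico 0 τ, x t ∈ LiePoisson.innerSet U ε) →
        (∃ y : ℝ → LiePoisson.PhaseSpace N n,
          LiePoisson.IsSolutionOn X (LiePoisson.hApprox X σ s α β) τ y ∧ y 0 = x 0) ∧
        ∀ y : ℝ → LiePoisson.PhaseSpace N n,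
          LiePoisson.IsSolutionOn X (LiePoisson.hApprox X σ s α β) τ y → y 0 = x 0 →
          ∀ t ∈ Set.Ico 0 τ, dist (x t) (y t) < ε := by
  obtain ⟨χ, hχ⟩ := exists_contDiffBump_eventuallyEq_one hU
  -- cutting `h` off outside `U` makes its field globally Lipschitz
  set hc : PhaseSpace N n → ℝ := fun z => χ z * h z with hhc
  have hc_smooth : ContDiff ℝ ∞ hc := χ.contDiff.mul hh
  have hc_supp : HasCompactSupport hc := χ.hasCompactSupport.mul_right
  obtain ⟨K, hK⟩ := ContDiff.lipschitzWith_of_hasCompactSupport (𝕂 := ℝ)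
    (hasCompactSupport_hamiltonianField X hc_supp) (contDiff_hamiltonianField X hc_smooth) (by simp)
  have hfield : ∀ z ∈ U, hamiltonianField X hc z = hamiltonianField X h z := by
    intro z hz
    rw [hamiltonianField_eq, hamiltonianField_eq, gradient_congr_of_eventuallyEq]
    filter_upwards [hχ z hz] with w hw
    simp [hhc, hw]
  obtain ⟨δ, hδ, hbound⟩ := exists_pos_gronwallBound_lt K T hε
  obtain ⟨R, hR⟩ := hU.isBounded.exists_norm_le
  set C := ‖poissonCLM X N‖ * |R| with hC
  have hC0 : 0 < C + 1 := by positivity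
  obtain ⟨M, s, α, β, hM, hs, hnear⟩ := exists_hApprox_gradient_near X hσ_smooth hσ_not_poly
    hc_smooth hc_supp hU (div_pos hδ hC0)
  refine ⟨M, s, α, β, hM, fun j => (hs j).imp_right And.left,
    fun hb j => (hs j).resolve_right fun hj => hj.2 hb, ?_⟩
  set H := hApprox X σ s α β with hH
  have hclose : ∀ z ∈ U, dist (hamiltonianField X H z) (hamiltonianField X hc z) ≤ δ := by
    intro z hz
    calc _ ≤ ‖poissonCLM X N‖ * ‖z‖ * ‖gradient H z - gradient hc z‖ :=
          dist_hamiltonianField_le X H hc z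
      _ ≤ C * (δ / (C + 1)) := by
          gcongr
          · exact mul_le_mul_of_nonneg_left ((hR z hz).trans (le_abs_self R))
              (norm_nonneg (poissonCLM X N))
          · exact (hnear z hz).le
      _ = C / (C + 1) * δ := by ring
      _ ≤ 1 * δ := by
          gcongr
          rw [div_le_one hC0]
          linarith
      _ = δ := one_mul δ
  intro τ x _ hτT hx hxU
  have hxc : ∀ t ∈ Ico 0 τ, HasDerivWithinAt x (hamiltonianField X hc (x t)) (Ico 0 τ) t := by
    intro t ht
    rw [hfield _ (hxU t ht).1]
    exact hx t ht
  have hball : ∀ t ∈ Ico 0 τ, Metric.ball (x t) ε ⊆ U := fun t ht =>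
    ball_subset_of_lt_infEDist_frontier (hxU t ht).1 (hxU t ht).2
  refine ⟨?_, fun y hy hy0 => dist_lt_of_field_near hK hδ.le hτT hbound hclose hxc hy hy0 hball⟩
  -- the field of `H` may blow up, but a trajectory of the field cut off outside `U` stays near `x`,
  -- hence in `U`, where the cut-off has no effect
  set G : PhaseSpace N n → PhaseSpace N n := fun z => χ z • hamiltonianField X H z with hG
  have hG_smooth : ContDiff ℝ ∞ G :=
    χ.contDiff.smul (contDiff_hamiltonianField X (contDiff_hApprox X hσ_smooth s α β))
  have hG_supp : HasCompactSupport G := χ.hasCompactSupport.smul_right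
  have hGU : ∀ z ∈ U, G z = hamiltonianField X H z := by
    intro z hz
    have : χ z = 1 := (hχ z hz).self_of_nhds
    simp [hG, this]
  obtain ⟨K', hK'⟩ := ContDiff.lipschitzWith_of_hasCompactSupport (𝕂 := ℝ) hG_supp hG_smooth
    (by simp)
  obtain ⟨L, hL⟩ := hG_supp.exists_bound_of_continuous hG_smooth.continuous
  obtain ⟨y, hy0, hy⟩ := exists_trajectory_of_lipschitz_of_bounded hK'
    (fun z => (hL z).trans (Real.le_coe_toNNReal L)) ⟨T, hT.le⟩ (x 0)
  have hyτ : ∀ t ∈ Ico 0 τ, HasDerivWithinAt y (G (y t)) (Ico 0 τ) t := fun t ht =>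
    (hy t ⟨ht.1, ht.2.le.trans hτT⟩).mono fun u hu => ⟨hu.1, hu.2.le.trans hτT⟩
  have hdist := dist_lt_of_field_near hK hδ.le hτT hbound
    (fun z hz => by rw [hGU z hz]; exact hclose z hz) hxc hyτ hy0 hball
  refine ⟨y, fun t ht => ?_, hy0⟩
  change HasDerivWithinAt y (hamiltonianField X H (y t)) (Ico 0 τ) t
  rw [← hGU _ (hball t ht (by rw [Metric.mem_ball, dist_comm]; exact hdist t ht))]
  exact hyτ t ht
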